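/- Let $p$ be an odd prime, let $k$ be an algebraically closed field of characteristic $0$, and let $V_n$ be the elementary abelian $p$-group of order $p^n$, regarded as an $n$-dimensional vector space over $\mathbb{F}_p$, with dual space $V_n^*=\operatorname{Hom}(V_n,\mathbb{F}_p)$. Let $H^3(V_n,k^\times)$ be the third group cohomology of $V_n$ with coefficients in the trivial module $k^\times$. The group $GL_n(\mathbb{F}_p)=\operatorname{Aut}(V_n)$ acts on $H^3(V_n,k^\times)$ by $(g\cdot\omega)(u,v,w)=\omega(g^{-1}u,g^{-1}v,g^{-1}w)$, on $V_n^*$ by $(g\cdot f)(v)=f(g^{-1}v)$, and on the exterior and symmetric powers of $V_n^*$ by the induced actions. Then there is an isomorphism of $GL_n(\mathbb{F}_p)$-modules $$H^3(V_n,k^\times)\;\cong\;{\bigwedge}^3(V_n^*)\,\oplus\,\operatorname{Sym}^2(V_n^*).$$ -/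

import Mathlib

open CategoryTheory
open scoped TensorProduct

universe u

noncomputable section

namespace ElemAbelian

/-! ### Functoriality of symmetric powers -/

section SymmetricPower

variable {R ι : Type} [CommRing R] {M N P : Type u} [AddCommGroup M] [Module R M]
  [AddCommGroup N] [Module R N] [AddCommGroup P] [Module R P]

/-- The linear map `Sym^ι M → Sym^ι N` induced by a linear map `f : M → N`; it sends the class of
`⨂ mᵢ` to the class of `⨂ f(mᵢ)`. -/
def symPowMap (f : M →ₗ[R] N) : SymmetricPower R ι M →ₗ[R] SymmetricPower R ι N where
  toFun := AddCon.lift (addConGen (SymmetricPower.Rel R ι M))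
    ((SymmetricPower.mk R ι N).toAddMonoidHom.comp
      (PiTensorProduct.map (fun _ : ι => f)).toAddMonoidHom)
    (by
      refine AddCon.addConGen_le.2 ?_
      rintro _ _ ⟨e, m⟩
      change SymmetricPower.mk R ι N (PiTensorProduct.map (fun _ : ι => f)
          (PiTensorProduct.tprod R m)) =
        SymmetricPower.mk R ι N (PiTensorProduct.map (fun _ : ι => f)
          (PiTensorProduct.tprod R fun i => m (e i)))
      rw [PiTensorProduct.map_tprod, PiTensorProduct.map_tprod]
      exact (SymmetricPower.tprod_equiv e (fun i => f (m i))).symm)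
  map_add' x y := map_add _ x y
  map_smul' r x := by
    induction x using AddCon.induction_on with
    | _ x =>
      change SymmetricPower.mk R ι N (PiTensorProduct.map (fun _ : ι => f) (r • x)) =
        r • SymmetricPower.mk R ι N (PiTensorProduct.map (fun _ : ι => f) x)
      rw [map_smul, map_smul]

theorem symPowMap_tprod (f : M →ₗ[R] N) (m : ι → M) :
    symPowMap f (SymmetricPower.tprod R m) = SymmetricPower.tprod R (fun i => f (m i)) := by
  change SymmetricPower.mk R ι N (PiTensorProduct.map (fun _ : ι => f)
    (PiTensorProduct.tprod R m)) = _
  rw [PiTensorProduct.map_tprod]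
  rfl

theorem symPow_hom_ext {f g : SymmetricPower R ι M →ₗ[R] P}
    (h : ∀ m : ι → M, f (SymmetricPower.tprod R m) = g (SymmetricPower.tprod R m)) : f = g := by
  refine LinearMap.ext_on_range (v := SymmetricPower.tprod R (ι := ι) (M := M)) ?_ h
  exact SymmetricPower.span_tprod_eq_top R ι M

theorem symPowMap_id : symPowMap (ι := ι) (LinearMap.id : M →ₗ[R] M) = LinearMap.id :=
  symPow_hom_ext fun m => by simp [symPowMap_tprod]

theorem symPowMap_comp (g : N →ₗ[R] P) (f : M →ₗ[R] N) :
    symPowMap (ι := ι) (g ∘ₗ f) = symPowMap g ∘ₗ symPowMap f :=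
  symPow_hom_ext fun m => by simp [symPowMap_tprod]

end SymmetricPower

/-! ### Exterior and symmetric powers of a representation -/

section Powers

variable {R : Type} [CommRing R] {G : Type u} [Group G] {M : Type u} [AddCommGroup M] [Module R M]

/-- The representation on `⋀ᵈ M` induced by a representation on `M`. -/
def exteriorPowerRep (d : ℕ) (ρ : Representation R G M) : Representation R G (⋀[R]^d M) where
  toFun g := exteriorPower.map d (ρ g)
  map_one' := by
    rw [map_one]
    exact exteriorPower.map_id
  map_mul' g h := by
    rw [map_mul]
    exact exteriorPower.map_comp (ρ h) (ρ g)

/-- The representation on `Symᵈ M` induced by a representation on `M`. -/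
def symmetricPowerRep (d : ℕ) (ρ : Representation R G M) :
    Representation R G (SymmetricPower R (Fin d) M) where
  toFun g := symPowMap (ρ g)
  map_one' := by
    rw [map_one]
    exact symPowMap_id
  map_mul' g h := by
    rw [map_mul]
    exact symPowMap_comp (ρ g) (ρ h)

end Powers

variable (p : ℕ) (V : Type u) [AddCommGroup V] [Module (ZMod p) V]

/-- The dual `V^* = Hom(V, 𝔽_p)` as a `GL(V)`-module: `(g • f)(v) = f(g⁻¹ v)`. -/
def dualRep : Representation (ZMod p) (LinearMap.GeneralLinearGroup (ZMod p) V)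
    (Module.Dual (ZMod p) V) :=
  Representation.dual (Units.coeHom (V →ₗ[ZMod p] V))

/-! ### The cohomology of `V` with coefficients in `k^×` -/

section Cohomology

variable (k : Type u) [Field k]

/-- The multiplicative group `k^×`, written additively, as a trivial module over the group
underlying `V`. The ring of integers is lifted to the universe of `V` and `k`. -/
abbrev unitsCoeff : Rep.{u} (ULift.{u} ℤ) (Multiplicative V) :=
  Rep.trivial (ULift.{u} ℤ) (Multiplicative V) (Additive kˣ)

/-- The group cohomology `H^m(V, k^×)` with trivial action of `V` on `k^×`. -/
abbrev unitsCohomology (m : ℕ) : ModuleCat (ULift.{u} ℤ) :=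
  groupCohomology (unitsCoeff V k) m

variable {p V}

/-- A linear endomorphism of `V` as an endomorphism of the group underlying `V`. -/
abbrev endHom (f : V →ₗ[ZMod p] V) : Multiplicative V →* Multiplicative V :=
  AddMonoidHom.toMultiplicative f.toAddMonoidHom

/-- The pullback `f^* : H^m(V, k^×) → H^m(V, k^×)` along a linear map `f : V → V`, given on cochains
by `(f^* ω)(v₁, …, v_m) = ω(f v₁, …, f v_m)`. -/
def pullback (m : ℕ) (f : V →ₗ[ZMod p] V) : unitsCohomology V k m ⟶ unitsCohomology V k m :=
  groupCohomology.map (A := unitsCoeff V k) (B := unitsCoeff V k) (endHom f)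
    (𝟙 (unitsCoeff V k)) m

theorem pullback_id (m : ℕ) :
    pullback k m (LinearMap.id : V →ₗ[ZMod p] V) = 𝟙 (unitsCohomology V k m) :=
  groupCohomology.map_id m

theorem pullback_comp (m : ℕ) (f g : V →ₗ[ZMod p] V) :
    pullback k m (f ∘ₗ g) = pullback k m f ≫ pullback k m g :=
  groupCohomology.map_comp (A := unitsCoeff V k) (B := unitsCoeff V k) (C := unitsCoeff V k)
    (endHom f) (endHom g) (𝟙 _) (𝟙 _) m

variable (p V)

/-- `H^m(V, k^×)` as a `GL(V)`-module: `g` acts by pullback along `g⁻¹`, that is,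
`(g • ω)(v₁, …, v_m) = ω(g⁻¹ v₁, …, g⁻¹ v_m)` on cochains. -/
def cohomologyRep (m : ℕ) : Representation (ULift.{u} ℤ) (LinearMap.GeneralLinearGroup (ZMod p) V)
    (unitsCohomology V k m) where
  toFun g := (pullback k m ((g⁻¹ : LinearMap.GeneralLinearGroup (ZMod p) V) :
    V →ₗ[ZMod p] V)).hom
  map_one' := by
    rw [inv_one]
    exact congrArg ModuleCat.Hom.hom (pullback_id k m)
  map_mul' g h := by
    rw [mul_inv_rev, Units.val_mul]
    exact congrArg ModuleCat.Hom.hom (pullback_comp k m _ _)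

end Cohomology

end ElemAbelian

end

noncomputable section

namespace ElemAbelian

/-! ### A cohomology bound along a surjection onto a cyclic group -/

section CyclicQuotient

/-! Both summands are realised by explicit cocycles. Three linear forms give the cup product f ∪ g ∪
h, and two give f ∪ βg, where the Bockstein βg is the carry cocycle of g; values in ℤ/p are sent to
the p-th roots of unity. As 2 is invertible mod p, a cup product with a repeated form is a
coboundary, so the first kind factors through ⋀³. The second kind becomes symmetric only in kˣ: up
to sign and a coboundary, f ∪ βg − g ∪ βf is the Bockstein of f ∪ g, which dies once p²-th roots of
unity are available (`cupBockstein_sub_swap_eq_twoCoboundary`). This yields `comparison`.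

Injectivity comes from two functionals that vanish on coboundaries. Antisymmetrisation, `altEval`,
recovers the alternating form and kills f ∪ βg; the sum of c(u, iu, u) over i < p, `cycEval`,
recovers the quadratic form and kills f ∪ g ∪ h.

Surjectivity is a count (`cardLE_units_two_three`). Let χ : G → ℤ/p be onto with kernel K, put A =
kˣ, let F be the A-valued functions of χ, and let N be the kernel of the sum F → A. By Shapiro,
Hⁱ(G, F) = Hⁱ(K, A). The short exact sequences N → F → A and A → F → N then bound H² and H³ by
induction on the rank, starting from H¹ = Hom(G, kˣ), and Pascal's rule turns the bound on H³ into
the order of ⋀³ ⊕ Sym². Equivariance already holds for the cocycles. -/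

theorem sum_zmod_eq_sum_range {A : Type*} [AddCommMonoid A] {p : ℕ} [NeZero p] (φ : ZMod p → A) :
    ∑ a, φ a = ∑ j ∈ Finset.range p, φ j := by
  refine Finset.sum_nbij' (fun a => a.val) (fun j => (j : ZMod p)) ?_ ?_ ?_ ?_ ?_
  · intro a _
    exact Finset.mem_range.2 a.val_lt
  · intro j _
    exact Finset.mem_univ _
  · intro a _
    exact ZMod.natCast_zmod_val a
  · intro j hj
    exact ZMod.val_cast_of_lt (Finset.mem_range.1 hj)
  · intro a _
    rw [ZMod.natCast_zmod_val]

/-- Partial sums provide an antidifference on ℤ/p: the vanishing total is what makes them consistent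
at the wrap-around from p − 1 to 0. -/
theorem sum_range_val_add_one {A : Type*} [AddCommGroup A] {p : ℕ} [NeZero p] (φ : ZMod p → A)
    (hφ : ∑ a, φ a = 0) (a : ZMod p) :
    ∑ j ∈ Finset.range (1 + a).val, φ j = ∑ j ∈ Finset.range a.val, φ j + φ a := by
  have key : ∑ j ∈ Finset.range a.val, φ j + φ a = ∑ j ∈ Finset.range (a.val + 1), φ j := by
    rw [Finset.sum_range_succ, ZMod.natCast_zmod_val]
  rw [key]
  by_cases h : a.val + 1 < p
  · have : (1 + a).val = a.val + 1 := by
      have h1 : (1 + a) = ((a.val + 1 : ℕ) : ZMod p) := by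
        push_cast
        rw [ZMod.natCast_zmod_val, add_comm]
      rw [h1, ZMod.val_cast_of_lt h]
    rw [this]
  · have h2 : a.val + 1 = p := by
      have := a.val_lt
      omega
    have h1 : (1 + a) = 0 := by
      have : ((a.val + 1 : ℕ) : ZMod p) = 0 := by rw [h2, ZMod.natCast_self]
      rw [← this]
      push_cast
      rw [ZMod.natCast_zmod_val, add_comm]
    rw [h1, h2, ZMod.val_zero, Finset.range_zero, Finset.sum_empty, ← hφ, sum_zmod_eq_sum_range]

variable (R : Type u) {G : Type u} [CommRing R] [CommGroup G] {p : ℕ}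
  (χ : G →* Multiplicative (ZMod p)) (A : Type u) [AddCommGroup A] [Module R A]

/-- The representation of `G` on functions `G → A` invariant under the kernel of `χ`. -/
abbrev kerCoind : Rep.{u} R G := Rep.coind χ.ker.subtype (Rep.trivial R χ.ker A)

variable {R A χ}

/-- Such functions factor through χ, so they are functions on ℤ/p. -/
theorem kerCoind_apply_eq (f : kerCoind R χ A) {x y : G} (h : χ x = χ y) : f.1 x = f.1 y := by
  have := f.2 ⟨x * y⁻¹, by simp [MonoidHom.mem_ker, h]⟩ y
  simpa using this

variable (χ)

/-- The function on `G` obtained from a function on `ℤ/p`. -/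
def kerCoindMk (φ : ZMod p → A) : kerCoind R χ A :=
  ⟨fun x => φ (χ x).toAdd, fun s x => by
    have : χ (s : G) = 1 := s.2
    simp [this]⟩

variable (R A) in
/-- The inclusion of `A` as constant functions. -/
def constHom : Rep.trivial R G A ⟶ kerCoind R χ A :=
  Rep.ofHom
    { toFun := fun a => kerCoindMk χ fun _ => a
      map_add' := fun _ _ => rfl
      map_smul' := fun _ _ => rfl
      isIntertwining' := fun _ => rfl }

variable (R A) in
/-- The difference operator `f ↦ f (t * ·) - f`. -/
def shiftHom (t : G) : kerCoind R χ A ⟶ kerCoind R χ A :=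
  Rep.ofHom
    { toFun := fun f => ⟨fun x => f.1 (t * x) - f.1 x, fun s x => by
        have : χ (s : G) = 1 := s.2
        simp only [Rep.trivial, Representation.trivial_apply]
        rw [kerCoind_apply_eq f (x := t * (χ.ker.subtype s * x)) (y := t * x) (by simp [this]),
          kerCoind_apply_eq f (x := χ.ker.subtype s * x) (y := x) (by simp [this])]⟩
      map_add' := fun f g => by
        ext x
        exact add_sub_add_comm _ _ _ _
      map_smul' := fun r f => by
        ext x
        exact (smul_sub r (f.1 (t * x)) (f.1 x)).symm
      isIntertwining' := fun g => by
        ext f x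
        change f.1 (t * x * g) - f.1 (x * g) = f.1 (t * (x * g)) - f.1 (x * g)
        rw [mul_assoc] }

variable (R A) in
/-- The sum of the values of an invariant function over a set of representatives `s`. -/
def sumHom [NeZero p] {s : ZMod p → G} (hs : ∀ a, χ (s a) = Multiplicative.ofAdd a) :
    kerCoind R χ A ⟶ Rep.trivial R G A :=
  Rep.ofHom
    { toFun := fun f => ∑ a, f.1 (s a)
      map_add' := fun f g => Finset.sum_add_distrib
      map_smul' := fun r f => (Finset.smul_sum (r := r) (f := fun a => f.1 (s a))).symm
      isIntertwining' := fun g => by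
        ext f
        change ∑ a, f.1 (s a * g) = ∑ a, f.1 (s a)
        refine Fintype.sum_equiv (Equiv.addRight (χ g).toAdd) _ _ fun a => ?_
        refine kerCoind_apply_eq f ?_
        rw [map_mul, hs, hs]
        rfl }

variable [NeZero p] {s : ZMod p → G} (hs : ∀ a, χ (s a) = Multiplicative.ofAdd a)

theorem sumHom_kerCoindMk (φ : ZMod p → A) : (sumHom R χ A hs).hom (kerCoindMk χ φ) = ∑ a, φ a := by
  change ∑ a, φ (χ (s a)).toAdd = _
  simp [hs]

theorem sumHom_shiftHom (t : G) (f : kerCoind R χ A) :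
    (sumHom R χ A hs).hom ((shiftHom R χ A t).hom f) = 0 := by
  change ∑ a, (f.1 (t * s a) - f.1 (s a)) = 0
  rw [Finset.sum_sub_distrib, sub_eq_zero]
  refine Fintype.sum_equiv (Equiv.addLeft (χ t).toAdd) _ _ fun a => ?_
  refine kerCoind_apply_eq f ?_
  rw [map_mul, hs, hs]
  rfl

variable (R A) in
/-- The subrepresentation of functions with sum zero. -/
abbrev sumKer : Rep.{u} R G :=
  Rep.subrepresentation (kerCoind R χ A) (LinearMap.ker (sumHom R χ A hs).hom.toLinearMap)
    fun g f hf => by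
      have h := Rep.hom_comm_apply (sumHom R χ A hs) g f
      exact h.trans hf

theorem exact_of_hom {X : ShortComplex (Rep.{u} R G)}
    (h : ∀ x, X.g.hom x = 0 → ∃ y, X.f.hom y = x) : X.Exact := by
  rw [← ShortComplex.exact_map_iff_of_faithful X (forget₂ (Rep R G) (ModuleCat R)),
    ShortComplex.moduleCat_exact_iff]
  exact h

variable (R A) in
/-- The short complex `ker σ ⟶ F ⟶ A`. -/
abbrev sumKerComplex : ShortComplex (Rep.{u} R G) where
  X₁ := sumKer R χ A hs
  X₂ := kerCoind R χ A
  X₃ := Rep.trivial R G A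
  f := Rep.subtype _ _ _
  g := sumHom R χ A hs
  zero := by
    ext f
    exact f.2

theorem sumKerComplex_shortExact : (sumKerComplex R χ A hs).ShortExact where
  exact := exact_of_hom fun x hx => ⟨⟨x, hx⟩, rfl⟩
  mono_f := (Rep.mono_iff_injective _).2 Subtype.val_injective
  epi_g := (Rep.epi_iff_surjective _).2 fun a => ⟨kerCoindMk χ (Pi.single 0 a), by
    rw [sumHom_kerCoindMk]
    simp⟩

variable (R A) in
/-- The short complex `A ⟶ F ⟶ ker σ`. -/
abbrev constComplex : ShortComplex (Rep.{u} R G) where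
  X₁ := Rep.trivial R G A
  X₂ := kerCoind R χ A
  X₃ := sumKer R χ A hs
  f := constHom R χ A
  g := Rep.ofHom
    { toLinearMap := (shiftHom R χ A (s 1)).hom.toLinearMap.codRestrict _
        (sumHom_shiftHom χ hs (s 1))
      isIntertwining' := fun g => by
        ext f x
        exact congrFun (congrArg Subtype.val (Rep.hom_comm_apply (shiftHom R χ A (s 1)) g f)) x }
  zero := by
    ext a x
    exact sub_self a

/-- In the middle: `s 1` generates G modulo the kernel of χ, so a function invariant under its shift
is constant. On the right: a function with sum zero is the difference of its partial sums. -/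
theorem constComplex_shortExact : (constComplex R χ A hs).ShortExact where
  exact := exact_of_hom fun f hf => by
    have h1 : ∀ x, f.1 (s 1 * x) = f.1 x := fun x =>
      sub_eq_zero.1 (congrFun (congrArg Subtype.val (congrArg Subtype.val hf)) x)
    have h2 : ∀ n : ℕ, f.1 (s 1 ^ n) = f.1 1 := fun n => by
      induction n with
      | zero => rw [pow_zero]
      | succ n ih => rw [pow_succ', h1, ih]
    refine ⟨f.1 1, ?_⟩
    ext x
    change f.1 1 = f.1 x
    rw [← h2 (χ x).toAdd.val]
    refine kerCoind_apply_eq f ?_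
    rw [map_pow, hs, ← ofAdd_nsmul, nsmul_one, ZMod.natCast_zmod_val]
    rfl
  mono_f := (Rep.mono_iff_injective _).2 fun a b h =>
    congrFun (congrArg Subtype.val h) 1
  epi_g := (Rep.epi_iff_surjective _).2 fun f => by
    refine ⟨kerCoindMk χ fun a => ∑ j ∈ Finset.range a.val, f.1.1 (s j), ?_⟩
    ext x
    change ∑ j ∈ Finset.range (χ (s 1 * x)).toAdd.val, f.1.1 (s j) -
      ∑ j ∈ Finset.range (χ x).toAdd.val, f.1.1 (s j) = f.1.1 x
    rw [map_mul, hs, toAdd_mul, toAdd_ofAdd,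
      sum_range_val_add_one (fun a => f.1.1 (s a)) f.2, add_sub_cancel_left]
    exact kerCoind_apply_eq f.1 (by rw [hs, ofAdd_toAdd])

end CyclicQuotient

/-! ### Upper bounds on cardinalities along exact sequences -/

section CardBounds

/-- The type is finite with at most `n` elements. -/
def CardLE (α : Type*) (n : ℕ) : Prop := Finite α ∧ Nat.card α ≤ n

theorem CardLE.of_equiv {α β : Type*} {n : ℕ} (h : CardLE α n) (e : α ≃ β) : CardLE β n :=
  have := h.1
  ⟨Finite.of_equiv α e, (Nat.card_congr e).symm.trans_le h.2⟩

theorem CardLE.of_injective {α β : Type*} {n : ℕ} (h : CardLE β n) {f : α → β}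
    (hf : Function.Injective f) : CardLE α n :=
  have := h.1
  ⟨Finite.of_injective f hf, (Nat.card_le_card_of_injective f hf).trans h.2⟩

theorem CardLE.mono {α : Type*} {m n : ℕ} (h : CardLE α m) (hmn : m ≤ n) : CardLE α n :=
  ⟨h.1, h.2.trans hmn⟩

/-- With r a set-theoretic section of g over its image, x is determined by g x and by a chosen
preimage under f of x − r(g x). -/
theorem CardLE.of_exact {R : Type*} [Ring R] {X : ShortComplex (ModuleCat R)} (hX : X.Exact)
    {m n : ℕ} (h₁ : CardLE X.X₁ m) (h₃ : CardLE X.X₃ n) : CardLE X.X₂ (m * n) := by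
  have := h₁.1
  have := h₃.1
  have hex := (ShortComplex.moduleCat_exact_iff X).1 hX
  let r := Function.invFun X.g.hom
  choose l hl using fun x : X.X₂ => hex (x - r (X.g.hom x)) (by
    change X.g.hom (x - r (X.g.hom x)) = 0
    rw [map_sub, sub_eq_zero]
    exact (Function.invFun_eq ⟨x, rfl⟩).symm)
  have hinj : Function.Injective fun x : X.X₂ => (l x, X.g.hom x) := fun x y hxy => by
    simp only [Prod.mk.injEq] at hxy
    have hx := hl x
    rw [hxy.1, hl y, hxy.2] at hx
    exact (sub_left_injective hx).symm
  exact CardLE.of_injective ⟨inferInstance, (Nat.card_prod _ _).trans_le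
    (Nat.mul_le_mul h₁.2 h₃.2)⟩ hinj

end CardBounds

/-! ### Dimension shifting through the coinduced module -/

section CohomologyBounds

variable {R G : Type u} [CommRing R] [CommGroup G] {p : ℕ} [NeZero p]
  {χ : G →* Multiplicative (ZMod p)} {A : Type u} [AddCommGroup A] [Module R A]

-- Shapiro's lemma.
omit [NeZero p] in
theorem cardLE_kerCoind {m n : ℕ}
    (h : CardLE (groupCohomology (Rep.trivial R χ.ker A) m) n) :
    CardLE (groupCohomology (kerCoind R χ A) m) n :=
  h.of_equiv (groupCohomology.coindIso (Rep.trivial R χ.ker A) m).toLinearEquiv.toEquiv.symm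

/-- The sum of the constant function b is p b. As A is p-divisible, every invariant of A lifts to an
invariant of F, the connecting map from H⁰ vanishes, and H¹ of the kernel embeds in H¹(G, F). -/
theorem cardLE_sumKer_one {s : ZMod p → G} (hs : ∀ a, χ (s a) = Multiplicative.ofAdd a)
    (hA : ∀ a : A, ∃ b, p • b = a) {n : ℕ}
    (h : CardLE (groupCohomology (Rep.trivial R χ.ker A) 1) n) :
    CardLE (groupCohomology (sumKer R χ A hs) 1) n := by
  have hX := sumKerComplex_shortExact (R := R) (A := A) χ hs
  have hδ : ∀ z, groupCohomology.δ hX 0 1 rfl z = 0 := by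
    intro z
    obtain ⟨z, rfl⟩ : ∃ w, (groupCohomology.H0Iso _).inv w = z :=
      ⟨(groupCohomology.H0Iso _).hom z, Iso.hom_inv_id_apply (groupCohomology.H0Iso _) z⟩
    obtain ⟨b, hb⟩ := hA z.1
    have := groupCohomology.δ₀_apply hX z (kerCoindMk χ fun _ => b) (by
      change (sumHom R χ A hs).hom (kerCoindMk χ fun _ => b) = _
      rw [sumHom_kerCoindMk]
      simp [hb]) 0 (by
      ext g x
      exact (sub_self b).symm)
    rw [this]
    exact map_zero _
  have hinj : Function.Injective (groupCohomology.mapShortComplex₁ hX (i := 0) rfl).g.hom := by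
    rw [injective_iff_map_eq_zero]
    intro x hx
    obtain ⟨y, rfl⟩ := (ShortComplex.moduleCat_exact_iff _).1
      (groupCohomology.mapShortComplex₁_exact hX rfl) x hx
    exact hδ y
  exact (cardLE_kerCoind h).of_injective hinj

/-- Long exact sequence of A → F → N, with N the kernel of the sum. -/
theorem cardLE_succ_succ {s : ZMod p → G} (hs : ∀ a, χ (s a) = Multiplicative.ofAdd a)
    {i m n : ℕ} (h₁ : CardLE (groupCohomology (sumKer R χ A hs) i) m)
    (h₂ : CardLE (groupCohomology (Rep.trivial R χ.ker A) (i + 1)) n) :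
    CardLE (groupCohomology (Rep.trivial R G A) (i + 1)) (m * n) :=
  CardLE.of_exact (groupCohomology.mapShortComplex₁_exact
    (constComplex_shortExact (R := R) (A := A) χ hs) (i := i) rfl) h₁ (cardLE_kerCoind h₂)

/-- Long exact sequence of N → F → A. -/
theorem cardLE_sumKer_succ {s : ZMod p → G} (hs : ∀ a, χ (s a) = Multiplicative.ofAdd a)
    {i m n : ℕ} (h₁ : CardLE (groupCohomology (Rep.trivial R G A) i) m)
    (h₂ : CardLE (groupCohomology (Rep.trivial R χ.ker A) (i + 1)) n) :
    CardLE (groupCohomology (sumKer R χ A hs) (i + 1)) (m * n) :=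
  CardLE.of_exact (groupCohomology.mapShortComplex₁_exact
    (sumKerComplex_shortExact (R := R) (A := A) χ hs) (i := i) rfl) h₁ (cardLE_kerCoind h₂)

end CohomologyBounds

/-! ### The order of H² and H³ with coefficients in kˣ -/

section UnitsBounds

variable (k : Type u) [Field k] [IsAlgClosed k] [CharZero k]

/-- For trivial coefficients H¹ is the character group Hom(G, kˣ), of order |G|. -/
theorem cardLE_units_one (G : Type u) [CommGroup G] [Finite G] :
    CardLE (groupCohomology (Rep.trivial (ULift.{u} ℤ) G (Additive kˣ)) 1) (Nat.card G) := by
  have h : CardLE (G →* kˣ) (Nat.card G) := by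
    have : NeZero (Monoid.exponent G) := ⟨Monoid.exponent_ne_zero_of_finite⟩
    have hc := CommGroup.card_monoidHom_of_hasEnoughRootsOfUnity G k
    exact ⟨Nat.finite_of_card_ne_zero (by rw [hc]; exact Nat.card_pos.ne'), hc.le⟩
  have e : (G →* kˣ) ≃ (Additive G →+ Additive kˣ) := MonoidHom.toAdditive
  exact h.of_equiv (e.trans (groupCohomology.H1IsoOfIsTrivial
    (Rep.trivial (ULift.{u} ℤ) G (Additive kˣ))).toLinearEquiv.toEquiv.symm)

theorem exists_nsmul_eq_units {p : ℕ} (hp : p ≠ 0) (a : Additive kˣ) : ∃ b, p • b = a := by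
  have : NeZero (p : k) := ⟨Nat.cast_ne_zero.2 hp⟩
  obtain ⟨b, hb⟩ := IsAlgClosed.exists_pow_nat_eq (a.toMul : k) (Nat.pos_of_ne_zero hp)
  have hb0 : b ≠ 0 := by
    rintro rfl
    rw [zero_pow hp] at hb
    exact a.toMul.ne_zero hb.symm
  exact ⟨Additive.ofMul (Units.mk0 b hb0), Additive.toMul.injective (Units.ext (by simpa using hb))⟩

theorem exists_surjective_dual (K : Type*) {W : Type*} [Field K] [AddCommGroup W] [Module K W]
    [Nontrivial W] : ∃ f : Module.Dual K W, Function.Surjective f := by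
  obtain ⟨g, hg⟩ := exists_ne (0 : W)
  obtain ⟨f, hf⟩ : ∃ f : Module.Dual K W, f g ≠ 0 := by
    by_contra! h
    exact hg ((Module.forall_dual_apply_eq_zero_iff K g).1 h)
  exact ⟨f, LinearMap.surjective fun h => hf (by rw [h, LinearMap.zero_apply])⟩

theorem exists_surjective_hom_zmod {p n : ℕ} [Fact p.Prime] (G : Type u) [CommGroup G]
    (hG : ∀ g : G, g ^ p = 1) (hn : Nat.card G = p ^ (n + 1)) :
    ∃ χ : G →* Multiplicative (ZMod p), Function.Surjective χ ∧ Nat.card χ.ker = p ^ n := by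
  have : Nontrivial G := by
    have : Finite G := Nat.finite_of_card_ne_zero (by rw [hn]; exact pow_ne_zero _ (NeZero.ne p))
    rw [← Finite.one_lt_card_iff_nontrivial, hn]
    exact Nat.one_lt_pow (by omega) (Fact.out : p.Prime).one_lt
  let _ : Module (ZMod p) (Additive G) := AddCommGroup.zmodModule hG
  obtain ⟨f, hf⟩ := exists_surjective_dual (ZMod p) (W := Additive G)
  let χ : G →* Multiplicative (ZMod p) := AddMonoidHom.toMultiplicativeRight f.toAddMonoidHom
  have hχ : Function.Surjective χ := fun a => hf a.toAdd
  refine ⟨χ, hχ, ?_⟩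
  have h1 := χ.ker.card_mul_index
  rw [Subgroup.index_ker, MonoidHom.range_eq_top.2 hχ, hn, Subgroup.card_top,
    Nat.card_congr Multiplicative.toAdd, Nat.card_zmod, pow_succ] at h1
  exact Nat.eq_of_mul_eq_mul_right (Fact.out : p.Prime).pos h1

/-- Both degrees are carried through the induction, since the bound on H³ of G uses the bound on H²
of the kernel. -/
theorem cardLE_units_two_three {p : ℕ} [Fact p.Prime] (n : ℕ) (G : Type u) [CommGroup G]
    (hG : ∀ g : G, g ^ p = 1) (hn : Nat.card G = p ^ n) :
    CardLE (groupCohomology (Rep.trivial (ULift.{u} ℤ) G (Additive kˣ)) 2) (p ^ n.choose 2) ∧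
    CardLE (groupCohomology (Rep.trivial (ULift.{u} ℤ) G (Additive kˣ)) 3)
      (p ^ (n.choose 3 + (n + 1).choose 2)) := by
  induction n generalizing G with
  | zero =>
    have : Subsingleton G := (Nat.card_eq_one_iff_unique.1 (by simpa using hn)).1
    have key : ∀ i, CardLE
        (groupCohomology (Rep.trivial (ULift.{u} ℤ) G (Additive kˣ)) (i + 1)) 1 := fun i => by
      have := ModuleCat.subsingleton_of_isZero
        (isZero_groupCohomology_succ_of_subsingleton
          (Rep.trivial (ULift.{u} ℤ) G (Additive kˣ)) i)
      exact ⟨inferInstance, Finite.card_le_one_iff_subsingleton.2 this⟩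
    exact ⟨by simpa using key 1, by simpa using key 2⟩
  | succ n ih =>
    have hfin : Finite G :=
      Nat.finite_of_card_ne_zero (by rw [hn]; exact pow_ne_zero _ (NeZero.ne p))
    obtain ⟨χ, hχ, hker⟩ := exists_surjective_hom_zmod G hG hn
    obtain ⟨ih₂, ih₃⟩ := ih χ.ker (fun g => Subtype.ext (hG g)) hker
    have hs : ∀ a, χ (Function.surjInv hχ (Multiplicative.ofAdd a)) = Multiplicative.ofAdd a :=
      fun a => Function.surjInv_eq hχ _
    have h₁ := cardLE_units_one k χ.ker
    rw [hker] at h₁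
    have h₁' := cardLE_units_one k G
    rw [hn] at h₁'
    have h₂ := cardLE_succ_succ hs
      (cardLE_sumKer_one hs (exists_nsmul_eq_units k (NeZero.ne p)) h₁) ih₂
    have h₃ := cardLE_succ_succ hs (cardLE_sumKer_succ hs h₁' ih₂) ih₃
    -- The exponents are n + C(n,2) = C(n+1,2) and (n+1) + C(n,2) + C(n,3) + C(n+1,2) = C(n+1,3) +
    -- C(n+2,2).
    refine ⟨h₂.mono (le_of_eq ?_), h₃.mono (le_of_eq ?_)⟩
    · rw [← pow_add, Nat.choose_succ_succ' n 1, Nat.choose_one_right]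
    · rw [← pow_add, ← pow_add, Nat.choose_succ_succ' n 2, Nat.choose_succ_succ' (n + 1) 1,
        Nat.choose_one_right]
      congr 1
      ring

end UnitsBounds

/-! ### Explicit 3-cocycles on an additive group with trivial coefficients -/

section Cocycles

variable (R : Type*) (V A : Type*) [Ring R] [AddCommGroup V] [AddCommGroup A] [Module R A]

/-- The module of 3-cocycles on `V` with values in the trivial module `A`. -/
def threeCocycles : Submodule R (V → V → V → A) where
  carrier := {c | ∀ u v w x, c v w x - c (u + v) w x + c u (v + w) x - c u v (w + x) + c u v w = 0}
  add_mem' {c c'} hc hc' u v w x := by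
    rw [← add_zero (0 : A)]
    nth_rw 1 [← hc u v w x, ← hc' u v w x]
    simp only [Pi.add_apply]
    abel
  zero_mem' u v w x := by simp
  smul_mem' r c hc u v w x := by
    have := congrArg (r • ·) (hc u v w x)
    simpa only [smul_add, smul_sub, smul_zero, Pi.smul_apply] using! this

variable {V A}

/-- The coboundary of a 2-cochain. -/
def twoCoboundary (b : V → V → A) (u v w : V) : A :=
  b v w - b (u + v) w + b u (v + w) - b u v

end Cocycles

/-! ### Cohomology classes of explicit 3-cocycles -/

section Classes

variable (R : Type u) (V A : Type u) [CommRing R] [AddCommGroup V] [AddCommGroup A] [Module R A]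

open groupCohomology

variable {V A} in
/-- A function of three variables in `V` as an inhomogeneous cochain. -/
def toCochain (c : V → V → V → A) : (Fin 3 → Multiplicative V) → A :=
  fun g => c (g 0).toAdd (g 1).toAdd (g 2).toAdd

variable {V A} in
/-- An inhomogeneous cochain as a function of three variables in `V`. -/
def ofCochain (c : (Fin 3 → Multiplicative V) → A) : V → V → V → A :=
  fun u v w => c ![.ofAdd u, .ofAdd v, .ofAdd w]

variable {V A}

omit [AddCommGroup V] [AddCommGroup A] in
theorem toCochain_ofCochain (c : (Fin 3 → Multiplicative V) → A) : toCochain (ofCochain c) = c := by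
  ext g
  refine congrArg c ?_
  ext i
  fin_cases i <;> rfl

theorem d_toCochain (c : V → V → V → A) (g : Fin 4 → Multiplicative V) :
    inhomogeneousCochains.d (Rep.trivial R (Multiplicative V) A) 3 (toCochain c) g =
      c (g 1).toAdd (g 2).toAdd (g 3).toAdd - c ((g 0).toAdd + (g 1).toAdd) (g 2).toAdd (g 3).toAdd
      + c (g 0).toAdd ((g 1).toAdd + (g 2).toAdd) (g 3).toAdd
      - c (g 0).toAdd (g 1).toAdd ((g 2).toAdd + (g 3).toAdd)
      + c (g 0).toAdd (g 1).toAdd (g 2).toAdd := by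
  rw [inhomogeneousCochains.d_hom_apply]
  simp only [Fin.sum_univ_succ, toCochain, Fin.contractNth]
  simp [pow_succ]
  abel

theorem d_two_eq (b : (Fin 2 → Multiplicative V) → A) :
    inhomogeneousCochains.d (Rep.trivial R (Multiplicative V) A) 2 b =
      toCochain (twoCoboundary fun u v => b ![.ofAdd u, .ofAdd v]) := by
  obtain ⟨c, rfl⟩ : ∃ c : V → V → A, b = fun g => c (g 0).toAdd (g 1).toAdd :=
    ⟨fun u v => b ![.ofAdd u, .ofAdd v], funext fun g => congrArg b (by
      ext i
      fin_cases i <;> rfl)⟩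
  ext g
  rw [inhomogeneousCochains.d_hom_apply]
  simp only [Fin.sum_univ_succ, toCochain, Fin.contractNth, twoCoboundary]
  simp [pow_succ]
  abel

theorem mem_threeCocycles_iff (c : V → V → V → A) : c ∈ threeCocycles R V A ↔
    inhomogeneousCochains.d (Rep.trivial R (Multiplicative V) A) 3 (toCochain c) = 0 := by
  constructor
  · intro h
    ext g
    rw [d_toCochain]
    exact h _ _ _ _
  · intro h u v w x
    have := congrFun h ![.ofAdd u, .ofAdd v, .ofAdd w, .ofAdd x]
    rwa [d_toCochain] at this

/-- A 3-cocycle as an element of the module of inhomogeneous cocycles. -/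
def cocycleMk (c : threeCocycles R V A) : cocycles (Rep.trivial R (Multiplicative V) A) 3 :=
  cocyclesMk (toCochain c.1) ((mem_threeCocycles_iff R c.1).1 c.2)

theorem iCocycles_cocycleMk (c : threeCocycles R V A) :
    (iCocycles (Rep.trivial R (Multiplicative V) A) 3).hom (cocycleMk R c) = toCochain c.1 :=
  iCocycles_mk (A := Rep.trivial R (Multiplicative V) A) _ ((mem_threeCocycles_iff R c.1).1 c.2)

theorem iCocycles_injective {G : Type u} [Group G] (M : Rep.{u} R G) (n : ℕ) :
    Function.Injective (iCocycles M n).hom :=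
  (ModuleCat.mono_iff_injective (iCocycles M n)).1 inferInstance

theorem cocycleMk_surjective : Function.Surjective (cocycleMk R (V := V) (A := A)) := by
  intro x
  have hx : inhomogeneousCochains.d (Rep.trivial R (Multiplicative V) A) 3
      ((iCocycles (Rep.trivial R (Multiplicative V) A) 3).hom x) = 0 := by
    have h := (inhomogeneousCochains (Rep.trivial R (Multiplicative V) A)).iCycles_d 3 4
    rw [inhomogeneousCochains.d_def] at h
    exact congrArg (fun f => f.hom x) h
  refine ⟨⟨ofCochain ((iCocycles (Rep.trivial R (Multiplicative V) A) 3).hom x), ?_⟩, ?_⟩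
  · rwa [mem_threeCocycles_iff, toCochain_ofCochain]
  · apply iCocycles_injective
    rw [iCocycles_cocycleMk, toCochain_ofCochain]

variable (V A) in
/-- The cohomology class of a 3-cocycle. -/
def cocycleClass : threeCocycles R V A →ₗ[R]
    groupCohomology (Rep.trivial R (Multiplicative V) A) 3 :=
  (π (Rep.trivial R (Multiplicative V) A) 3).hom ∘ₗ
    { toFun := cocycleMk R
      map_add' := fun c c' => by
        apply iCocycles_injective
        rw [map_add, iCocycles_cocycleMk, iCocycles_cocycleMk, iCocycles_cocycleMk]
        rfl
      map_smul' := fun r c => by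
        apply iCocycles_injective
        rw [map_smul, iCocycles_cocycleMk, iCocycles_cocycleMk]
        rfl }

theorem cocycleClass_surjective : Function.Surjective (cocycleClass R V A) :=
  fun x => groupCohomology_induction_on x fun y => by
    obtain ⟨c, rfl⟩ := cocycleMk_surjective R y
    exact ⟨c, rfl⟩

theorem π_eq_zero_iff {G : Type u} [Group G] (M : Rep.{u} R G) (n : ℕ) (x : cocycles M (n + 1)) :
    (π M (n + 1)).hom x = 0 ↔ ∃ b, inhomogeneousCochains.d M n b = (iCocycles M (n + 1)).hom x := by
  have hex : (ShortComplex.mk _ _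
      ((inhomogeneousCochains M).toCycles_comp_homologyπ n (n + 1))).Exact :=
    ShortComplex.exact_of_g_is_cokernel _
      ((inhomogeneousCochains M).homologyIsCokernel n (n + 1) (by simp))
  have hi : ∀ b, (iCocycles M (n + 1)).hom (((inhomogeneousCochains M).toCycles n (n + 1)).hom b) =
      inhomogeneousCochains.d M n b := fun b => by
    have h := (inhomogeneousCochains M).toCycles_i n (n + 1)
    rw [inhomogeneousCochains.d_def] at h
    exact congrArg (fun f => f.hom b) h
  constructor
  · intro h
    obtain ⟨b, rfl⟩ := (ShortComplex.moduleCat_exact_iff _).1 hex x h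
    exact ⟨b, (hi b).symm⟩
  · rintro ⟨b, hb⟩
    have : x = ((inhomogeneousCochains M).toCycles n (n + 1)).hom b :=
      iCocycles_injective R M (n + 1) (by rw [hi, hb])
    rw [this]
    exact congrArg (fun f => f.hom b) ((inhomogeneousCochains M).toCycles_comp_homologyπ n (n + 1))

omit [AddCommGroup V] [AddCommGroup A] in
theorem toCochain_injective : Function.Injective (toCochain (V := V) (A := A)) := by
  intro c c' h
  ext u v w
  exact congrFun h ![.ofAdd u, .ofAdd v, .ofAdd w]

theorem cocycleClass_eq_zero_iff (c : threeCocycles R V A) :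
    cocycleClass R V A c = 0 ↔ ∃ b, c.1 = twoCoboundary b := by
  refine (π_eq_zero_iff R (Rep.trivial R (Multiplicative V) A) 2 (cocycleMk R c)).trans ?_
  rw [iCocycles_cocycleMk]
  constructor
  · rintro ⟨b, hb⟩
    rw [d_two_eq] at hb
    exact ⟨_, (toCochain_injective hb).symm⟩
  · rintro ⟨b, hb⟩
    refine ⟨fun g => b (g 0).toAdd (g 1).toAdd, ?_⟩
    rw [d_two_eq, hb]
    rfl

end Classes

/-! ### Pullback on the level of cocycles -/

section Pullback

variable {p : ℕ} {V : Type u} [AddCommGroup V] [Module (ZMod p) V]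

/-- The pullback of a 3-cocycle along an additive map. -/
def threeCocyclesComap {R V W A : Type*} [Ring R] [AddCommGroup V] [AddCommGroup W]
    [AddCommGroup A] [Module R A] (f : V →+ W) (c : threeCocycles R W A) : threeCocycles R V A :=
  ⟨fun u v w => c.1 (f u) (f v) (f w), fun u v w x => by
    simpa only [map_add] using c.2 (f u) (f v) (f w) (f x)⟩

theorem pullback_cocycleClass (k : Type u) [Field k] (f : V →ₗ[ZMod p] V)
    (c : threeCocycles (ULift.{u} ℤ) V (Additive kˣ)) :
    (pullback k 3 f).hom (cocycleClass _ _ _ c) =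
      cocycleClass _ _ _ (threeCocyclesComap f.toAddMonoidHom c) := by
  refine (groupCohomology.π_map_apply (A := unitsCoeff V k) (B := unitsCoeff V k) (endHom f)
    (𝟙 (unitsCoeff V k)) 3 (cocycleMk _ c)).trans ?_
  refine congrArg (groupCohomology.π (unitsCoeff V k) 3).hom ?_
  apply iCocycles_injective
  have h := HomologicalComplex.cyclesMap_i (groupCohomology.cochainsMap (A := unitsCoeff V k)
    (B := unitsCoeff V k) (endHom f) (𝟙 (unitsCoeff V k))) 3
  refine (congrArg (fun f => f.hom (cocycleMk _ c)) h).trans ?_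
  refine Eq.trans ?_ (iCocycles_cocycleMk _ _).symm
  exact congrArg ((groupCohomology.cochainsMap (A := unitsCoeff V k)
    (B := unitsCoeff V k) (endHom f) (𝟙 (unitsCoeff V k))).f 3).hom (iCocycles_cocycleMk _ c)

end Pullback

/-! ### Invariants of 3-cocycles -/

section Invariants

variable (R : Type*) {V A : Type*} [Ring R] [AddCommGroup V] [AddCommGroup A] [Module R A]

/-- The alternating sum of the values of a cochain over the permutations of `u, v, w`. -/
def altEval (u v w : V) : threeCocycles R V A →+ A where
  toFun c := c.1 u v w + c.1 v w u + c.1 w u v - c.1 v u w - c.1 u w v - c.1 w v u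
  map_zero' := by simp
  map_add' c c' := by
    simp only [Submodule.coe_add, Pi.add_apply]
    abel

theorem altEval_apply (u v w : V) (c : threeCocycles R V A) : altEval R u v w c =
    c.1 u v w + c.1 v w u + c.1 w u v - c.1 v u w - c.1 u w v - c.1 w v u := rfl

/-- Commutativity of V makes the terms of the antisymmetrised coboundary cancel in pairs. -/
theorem altEval_eq_zero {c : threeCocycles R V A} {b : V → V → A} (h : c.1 = twoCoboundary b)
    (u v w : V) : altEval R u v w c = 0 := by
  rw [altEval_apply, h]
  simp only [twoCoboundary]
  rw [add_comm v u, add_comm w v, add_comm w u]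
  abel

/-- The sum of the values `c(u, iu, u)` over `i < p`. -/
def cycEval (p : ℕ) (u : V) : threeCocycles R V A →+ A where
  toFun c := ∑ i ∈ Finset.range p, c.1 u (i • u) u
  map_zero' := by simp
  map_add' c c' := by simp [Finset.sum_add_distrib]

theorem cycEval_apply (p : ℕ) (u : V) (c : threeCocycles R V A) :
    cycEval R p u c = ∑ i ∈ Finset.range p, c.1 u (i • u) u := rfl

/-- The sum telescopes in b(u, iu) − b(iu, u), whose values at i = p and i = 0 agree because p u =
0. -/
theorem cycEval_eq_zero {c : threeCocycles R V A} {b : V → V → A} (h : c.1 = twoCoboundary b)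
    {p : ℕ} {u : V} (hu : p • u = 0) : cycEval R p u c = 0 := by
  have key : ∀ i : ℕ, c.1 u (i • u) u =
      (b u ((i + 1) • u) - b ((i + 1) • u) u) - (b u (i • u) - b (i • u) u) := fun i => by
    rw [h]
    simp only [twoCoboundary]
    rw [add_comm u (i • u), ← succ_nsmul]
    abel
  rw [cycEval_apply, Finset.sum_congr rfl fun i _ => key i,
    Finset.sum_range_sub (fun i => b u (i • u) - b (i • u) u), hu, zero_nsmul, sub_self]

end Invariants

/-! ### Cup products -/

section Carry

variable {p : ℕ} [NeZero p]

/-- The carry in the addition of two residues modulo `p`. -/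
def carry (a b : ZMod p) : ℤ := ((a.val : ℤ) + b.val - (a + b).val) / p

theorem mul_carry (a b : ZMod p) : (p : ℤ) * carry a b = a.val + b.val - (a + b).val := by
  refine Int.mul_ediv_cancel' ?_
  rw [← ZMod.intCast_zmod_eq_zero_iff_dvd]
  simp

omit [NeZero p] in
theorem carry_comm (a b : ZMod p) : carry a b = carry b a := by
  rw [carry, carry, add_comm a b, add_comm (a.val : ℤ)]

/-- Up to the factor p, which cancels in ℤ, the carry is the coboundary of the integer lift
`ZMod.val`. -/
theorem carry_cocycle (a b c : ZMod p) :
    carry b c - carry (a + b) c + carry a (b + c) - carry a b = 0 := by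
  have hp : (p : ℤ) ≠ 0 := Nat.cast_ne_zero.2 (NeZero.ne p)
  apply mul_left_cancel₀ hp
  rw [mul_sub, mul_add, mul_sub, mul_carry, mul_carry, mul_carry, mul_carry, add_assoc a b c]
  ring

theorem sum_carry (a : ZMod p) : ∑ i ∈ Finset.range p, carry (i • a) a = a.val := by
  have hp : (p : ℤ) ≠ 0 := Nat.cast_ne_zero.2 (NeZero.ne p)
  apply mul_left_cancel₀ hp
  have key : ∀ i : ℕ, (p : ℤ) * carry (i • a) a =
      a.val - (((((i + 1) • a : ZMod p)).val : ℤ) - ((i • a : ZMod p)).val) := fun i => by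
    rw [mul_carry, succ_nsmul]
    ring
  rw [Finset.mul_sum, Finset.sum_congr rfl fun i _ => key i, Finset.sum_sub_distrib,
    Finset.sum_range_sub (fun i : ℕ => (((i • a : ZMod p)).val : ℤ))]
  simp

end Carry

section CupProducts

variable {p : ℕ} [Fact p.Prime] {V : Type*} [AddCommGroup V] [Module (ZMod p) V]

/-- The cup product of three linear forms. -/
def tripleCup : MultilinearMap (ZMod p) (fun _ : Fin 3 => Module.Dual (ZMod p) V)
    (threeCocycles (ZMod p) V (ZMod p)) where
  toFun m := ⟨fun u v w => m 0 u * m 1 v * m 2 w, fun u v w x => by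
    simp only [map_add]
    ring⟩
  map_update_add' {inst} m i f g := by
    obtain rfl := Subsingleton.elim inst (instDecidableEqFin 3)
    ext u v w
    fin_cases i <;> simp [Function.update] <;> ring
  map_update_smul' {inst} m i c f := by
    obtain rfl := Subsingleton.elim inst (instDecidableEqFin 3)
    ext u v w
    fin_cases i <;> simp [Function.update] <;> ring

theorem tripleCup_apply (m : Fin 3 → Module.Dual (ZMod p) V) (u v w : V) :
    (tripleCup m).1 u v w = m 0 u * m 1 v * m 2 w := rfl

theorem two_ne_zero_of_odd (hp : Odd p) : (2 : ZMod p) ≠ 0 := by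
  intro h
  have h2 : p ∣ 2 := (ZMod.natCast_eq_zero_iff 2 p).1 (by exact_mod_cast h)
  obtain rfl := (Nat.prime_dvd_prime_iff_eq (Fact.out : p.Prime) Nat.prime_two).1 h2
  exact absurd hp (by decide)

/-- For adjacent equal forms, f ∪ f is the coboundary of −f²/2, which needs p odd. -/
theorem tripleCup_eq_twoCoboundary (hp : Odd p) (m : Fin 3 → Module.Dual (ZMod p) V) {i j : Fin 3}
    (hm : m i = m j) (hij : i ≠ j) : ∃ b, (tripleCup m).1 = twoCoboundary b := by
  have h2 := two_ne_zero_of_odd hp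
  have h01 : m 0 = m 1 → ∃ b, (tripleCup m).1 = twoCoboundary b := fun h => by
    refine ⟨fun u v => - (2⁻¹ * (m 1 u * m 1 u * m 2 v)), ?_⟩
    ext u v w
    simp only [tripleCup_apply, twoCoboundary, map_add, h]
    field_simp
    ring
  have h12 : m 1 = m 2 → ∃ b, (tripleCup m).1 = twoCoboundary b := fun h => by
    refine ⟨fun u v => 2⁻¹ * (m 0 u * m 2 v * m 2 v), ?_⟩
    ext u v w
    simp only [tripleCup_apply, twoCoboundary, map_add, h]
    field_simp
    ring
  -- With f = m 0 = m 2 and g = m 1, the first summand has coboundary f ∪ g ∪ f + g ∪ f ∪ f; the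
  -- second removes g ∪ f ∪ f as in `h12`.
  have h02 : m 0 = m 2 → ∃ b, (tripleCup m).1 = twoCoboundary b := fun h => by
    refine ⟨fun u v => - (m 2 u * m 1 u * m 2 v) - 2⁻¹ * (m 1 u * m 2 v * m 2 v), ?_⟩
    ext u v w
    simp only [tripleCup_apply, twoCoboundary, map_add, h]
    field_simp
    ring
  fin_cases i <;> fin_cases j
  exacts [absurd rfl hij, h01 hm, h02 hm, h01 hm.symm, absurd rfl hij, h12 hm, h02 hm.symm,
    h12 hm.symm, absurd rfl hij]

theorem altEval_tripleCup (m : Fin 3 → Module.Dual (ZMod p) V) (v : Fin 3 → V) :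
    altEval (ZMod p) (v 0) (v 1) (v 2) (tripleCup m) = Matrix.det (.of fun i j => m i (v j)) := by
  rw [Matrix.det_fin_three, altEval_apply]
  simp only [tripleCup_apply, Matrix.of_apply]
  ring

theorem cycEval_tripleCup (hp : Odd p) (m : Fin 3 → Module.Dual (ZMod p) V) (u : V) :
    cycEval (ZMod p) p u (tripleCup m) = 0 := by
  have h2 := two_ne_zero_of_odd hp
  rw [cycEval_apply]
  have key : ∀ i : ℕ, (tripleCup m).1 u (i • u) u = (i : ZMod p) * (m 0 u * m 1 u * m 2 u) :=
    fun i => by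
      rw [tripleCup_apply, map_nsmul, nsmul_eq_mul]
      ring
  rw [Finset.sum_congr rfl fun i _ => key i, ← Finset.sum_mul]
  -- Twice this sum is p(p − 1), and 2 is invertible.
  have hs : (∑ i ∈ Finset.range p, (i : ZMod p)) = 0 := by
    have h := congrArg (Nat.cast (R := ZMod p)) (Finset.sum_range_id_mul_two p)
    push_cast at h
    rw [ZMod.natCast_self, zero_mul] at h
    exact (mul_eq_zero.1 h).resolve_right h2
  rw [hs, zero_mul]

/-- The cup product of a linear form with the Bockstein of a linear form. -/
def cupBockstein (g : Module.Dual (ZMod p) V) :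
    Module.Dual (ZMod p) V →ₗ[ZMod p] threeCocycles (ZMod p) V (ZMod p) where
  toFun f := ⟨fun u v w => f u * (carry (g v) (g w) : ℤ), fun u v w x => by
    have h := congrArg (Int.cast (R := ZMod p)) (carry_cocycle (g v) (g w) (g x))
    push_cast at h
    simp only [map_add]
    linear_combination (- f u) * h⟩
  map_add' f f' := by
    ext u v w
    exact add_mul _ _ _
  map_smul' c f := by
    ext u v w
    exact mul_assoc _ _ _

theorem cupBockstein_apply (f g : Module.Dual (ZMod p) V) (u v w : V) :
    (cupBockstein g f).1 u v w = f u * (carry (g v) (g w) : ℤ) := rfl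

/-- The cocycle is symmetric in its last two arguments. -/
theorem altEval_cupBockstein (f g : Module.Dual (ZMod p) V) (u v w : V) :
    altEval (ZMod p) u v w (cupBockstein g f) = 0 := by
  simp only [altEval_apply, cupBockstein_apply]
  rw [carry_comm (g w) (g v), carry_comm (g w) (g u), carry_comm (g v) (g u)]
  ring

theorem cycEval_cupBockstein (f g : Module.Dual (ZMod p) V) (u : V) :
    cycEval (ZMod p) p u (cupBockstein g f) = f u * g u := by
  rw [cycEval_apply]
  simp only [cupBockstein_apply, map_nsmul]
  rw [← Finset.mul_sum, ← Int.cast_sum, sum_carry, Int.cast_natCast, ZMod.natCast_zmod_val]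

end CupProducts

/-! ### Change of coefficients -/

section Coefficients

variable {p : ℕ} [Fact p.Prime] {A : Type*} [AddCommGroup A] (ε : ℤ →+ A)
  (hε : ε ((p : ℤ) * p) = 0)

/-- The homomorphism `ℤ/p → A`, `n ↦ ε (p n)`. -/
def coeffHom : ZMod p →+ A :=
  ZMod.lift p ⟨ε.comp (AddMonoidHom.mulLeft (p : ℤ)), hε⟩

theorem coeffHom_intCast (n : ℤ) : coeffHom ε hε (n : ZMod p) = ε (p * n) :=
  ZMod.lift_coe p _ n

variable (R : Type*) [Ring R] [Module R A] {V : Type*} [AddCommGroup V]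

/-- The change of coefficients on 3-cocycles. -/
def threeCocyclesMap (ι : ZMod p →+ A) :
    threeCocycles (ZMod p) V (ZMod p) →+ threeCocycles R V A where
  toFun c := ⟨fun u v w => ι (c.1 u v w), fun u v w x => by
    have := congrArg ι (c.2 u v w x)
    simpa only [map_add, map_sub, map_zero] using this⟩
  map_zero' := by
    ext
    exact map_zero ι
  map_add' c c' := by
    ext
    exact map_add ι _ _

theorem threeCocyclesMap_apply (ι : ZMod p →+ A) (c : threeCocycles (ZMod p) V (ZMod p))
    (u v w : V) : (threeCocyclesMap R ι c).1 u v w = ι (c.1 u v w) := rfl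

theorem altEval_threeCocyclesMap (ι : ZMod p →+ A) (c : threeCocycles (ZMod p) V (ZMod p))
    (u v w : V) : altEval R u v w (threeCocyclesMap R ι c) = ι (altEval (ZMod p) u v w c) := by
  simp only [altEval_apply, threeCocyclesMap_apply, map_add, map_sub]

theorem cycEval_threeCocyclesMap (ι : ZMod p →+ A) (c : threeCocycles (ZMod p) V (ZMod p))
    (n : ℕ) (u : V) : cycEval R n u (threeCocyclesMap R ι c) = ι (cycEval (ZMod p) n u c) := by
  simp only [cycEval_apply, threeCocyclesMap_apply, map_sum]

theorem threeCocyclesMap_eq_twoCoboundary (ι : ZMod p →+ A)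
    {c : threeCocycles (ZMod p) V (ZMod p)} {b : V → V → ZMod p} (h : c.1 = twoCoboundary b) :
    (threeCocyclesMap R ι c).1 = twoCoboundary fun u v => ι (b u v) := by
  ext u v w
  rw [threeCocyclesMap_apply, h]
  simp only [twoCoboundary, map_add, map_sub]

/-- This is where coefficients larger than ℤ/p are needed: the correcting cochain contains ε of the
product of the integer lifts of f and g, while the image of ℤ/p only sees ε on multiples of p. -/
theorem cupBockstein_sub_swap_eq_twoCoboundary [Module (ZMod p) V] (f g : Module.Dual (ZMod p) V) :
    (threeCocyclesMap R (coeffHom ε hε) (cupBockstein g f - cupBockstein f g)).1 =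
      twoCoboundary fun u v =>
        coeffHom ε hε ((g u + g v) * (carry (f u) (f v) : ℤ)) - ε ((f u).val * (g v).val) := by
  ext u v w
  -- Over ℤ/p the difference is a coboundary plus the reduction of an integral cochain.
  have h₁ : f u * (carry (g v) (g w) : ℤ) - g u * (carry (f v) (f w) : ℤ) =
      ((g v + g w) * (carry (f v) (f w) : ℤ) - (g (u + v) + g w) * (carry (f (u + v)) (f w) : ℤ)
      + (g u + g (v + w)) * (carry (f u) (f (v + w)) : ℤ) - (g u + g v) * (carry (f u) (f v) : ℤ))
      + (((f u).val * carry (g v) (g w) - carry (f u) (f v) * (g w).val : ℤ) : ZMod p) := by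
    have h := congrArg (Int.cast (R := ZMod p)) (carry_cocycle (f u) (f v) (f w))
    push_cast at h
    push_cast
    simp only [ZMod.natCast_zmod_val, map_add]
    linear_combination (- (g u + g v + g w)) * h
  -- In ℤ, p times that integral cochain is minus the coboundary of the product of the lifts, so ε
  -- trivialises it.
  have h₂ : (p : ℤ) * ((f u).val * carry (g v) (g w) - carry (f u) (f v) * (g w).val) =
      - ((f v).val * (g w).val - (f (u + v)).val * (g w).val + (f u).val * (g (v + w)).val
        - (f u).val * (g v).val) := by
    have e₁ := mul_carry (g v) (g w)
    have e₂ := mul_carry (f u) (f v)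
    rw [map_add, map_add]
    linear_combination ((f u).val : ℤ) * e₁ - ((g w).val : ℤ) * e₂
  rw [threeCocyclesMap_apply]
  change coeffHom ε hε (f u * (carry (g v) (g w) : ℤ) - g u * (carry (f v) (f w) : ℤ)) = _
  rw [h₁, map_add, coeffHom_intCast, h₂]
  simp only [twoCoboundary, map_add, map_sub, map_neg]
  abel

end Coefficients

/-- Additive subgroups of a ℤ/p-module are submodules, so no linearity of the maps is required. -/
theorem addMonoidHom_eq_of_span_eq_top {p : ℕ} {M A : Type*} [AddCommGroup M] [Module (ZMod p) M]
    [AddCommGroup A] {S : Set M} (hS : Submodule.span (ZMod p) S = ⊤) {f g : M →+ A}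
    (h : Set.EqOn f g S) : f = g := by
  let N : Submodule (ZMod p) M := AddSubgroup.toZModSubmodule p (f.eqLocus g)
  have hN : Submodule.span (ZMod p) S ≤ N := Submodule.span_le.2 h
  ext x
  exact hN (hS ▸ Submodule.mem_top : x ∈ Submodule.span (ZMod p) S)

/-! ### The symmetric square -/

section SymmetricSquare

variable {R : Type} [CommRing R] {M N : Type*} [AddCommGroup M] [Module R M]
  [AddCommGroup N] [Module R N]

/-- A bilinear map as a multilinear map indexed by `Fin 2`. -/
def bilinToMultilinear (B : M →ₗ[R] M →ₗ[R] N) : MultilinearMap R (fun _ : Fin 2 => M) N where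
  toFun m := B (m 0) (m 1)
  map_update_add' {inst} m i f g := by
    obtain rfl := Subsingleton.elim inst (instDecidableEqFin 2)
    fin_cases i <;> simp [Function.update]
  map_update_smul' {inst} m i c f := by
    obtain rfl := Subsingleton.elim inst (instDecidableEqFin 2)
    fin_cases i <;> simp [Function.update]

/-- The linear map on the symmetric square induced by a symmetric bilinear map. -/
def symTwoLift (B : M →ₗ[R] M →ₗ[R] N) (hB : ∀ f g, B f g = B g f) :
    SymmetricPower R (Fin 2) M →ₗ[R] N where
  toFun := AddCon.lift (addConGen (SymmetricPower.Rel R (Fin 2) M))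
    (PiTensorProduct.lift (bilinToMultilinear B)).toAddMonoidHom
    (by
      refine AddCon.addConGen_le.2 ?_
      rintro _ _ ⟨e, m⟩
      change PiTensorProduct.lift (bilinToMultilinear B) (PiTensorProduct.tprod R m) =
        PiTensorProduct.lift (bilinToMultilinear B) (PiTensorProduct.tprod R fun i => m (e i))
      rw [PiTensorProduct.lift.tprod, PiTensorProduct.lift.tprod]
      change B (m 0) (m 1) = B (m (e 0)) (m (e 1))
      have he : (e 0 = 0 ∧ e 1 = 1) ∨ (e 0 = 1 ∧ e 1 = 0) := by
        revert e
        decide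
      rcases he with ⟨h0, h1⟩ | ⟨h0, h1⟩
      · rw [h0, h1]
      · rw [h0, h1, hB])
  map_add' x y := map_add _ x y
  map_smul' r x := by
    induction x using AddCon.induction_on with
    | _ x => exact map_smul (PiTensorProduct.lift (bilinToMultilinear B)) r x

theorem symTwoLift_tprod (B : M →ₗ[R] M →ₗ[R] N) (hB : ∀ f g, B f g = B g f) (m : Fin 2 → M) :
    symTwoLift B hB (SymmetricPower.tprod R m) = B (m 0) (m 1) :=
  PiTensorProduct.lift.tprod (φ := bilinToMultilinear B) m

variable {ι : Type*} [Fintype ι] (b : Module.Basis ι R M)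

/-- The polarised coordinates of a symmetric 2-tensor. -/
def symTwoCoord : SymmetricPower R (Fin 2) M →ₗ[R] (Sym2 ι → R) :=
  symTwoLift
    (LinearMap.mk₂ R
      (fun f g => fun z => Sym2.lift ⟨fun i j => b.repr f i * b.repr g j + b.repr f j * b.repr g i,
        fun i j => add_comm _ _⟩ z)
      (fun f f' g => by
        ext z
        induction z with | _ i j => simp; ring)
      (fun c f g => by
        ext z
        induction z with | _ i j => simp; ring)
      (fun f g g' => by
        ext z
        induction z with | _ i j => simp; ring)
      (fun c f g => by
        ext z
        induction z with | _ i j => simp; ring))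
    (fun f g => by
      ext z
      induction z with | _ i j => simp; ring)

omit [Fintype ι] in
theorem symTwoCoord_tprod (m : Fin 2 → M) (i j : ι) :
    symTwoCoord b (SymmetricPower.tprod R m) s(i, j) =
      b.repr (m 0) i * b.repr (m 1) j + b.repr (m 0) j * b.repr (m 1) i :=
  congrFun (symTwoLift_tprod _ _ m) s(i, j)

/-- The symmetric 2-tensor with given polarised coordinates, up to a factor two. -/
def symTwoOfCoord : (Sym2 ι → R) →ₗ[R] SymmetricPower R (Fin 2) M :=
  ∑ i, ∑ j, (LinearMap.proj s(i, j)).smulRight (SymmetricPower.tprod R ![b i, b j])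

theorem symTwoOfCoord_apply (c : Sym2 ι → R) : symTwoOfCoord b c =
    ∑ i, ∑ j, c s(i, j) • SymmetricPower.tprod R ![b i, b j] := by
  simp [symTwoOfCoord]

theorem tprod_pair_swap (f g : M) :
    SymmetricPower.tprod R ![f, g] = SymmetricPower.tprod R ![g, f] := by
  rw [← SymmetricPower.tprod_equiv (Equiv.swap (0 : Fin 2) 1) ![f, g]]
  congr 1
  ext i
  fin_cases i <;> rfl

theorem tprod_pair_eq_sum (f g : M) : SymmetricPower.tprod R ![f, g] =
    ∑ i, ∑ j, (b.repr f i * b.repr g j) • SymmetricPower.tprod R ![b i, b j] := by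
  classical
  have h : ![f, g] = fun k => ∑ j, b.repr (![f, g] k) j • b j :=
    funext fun k => (b.sum_repr _).symm
  conv_lhs => rw [h]
  rw [MultilinearMap.map_sum, ← Fintype.sum_prod_type' fun i j =>
    (b.repr f i * b.repr g j) • SymmetricPower.tprod R ![b i, b j]]
  refine Fintype.sum_equiv (finTwoArrowEquiv ι) _ _ fun r => ?_
  rw [MultilinearMap.map_smul_univ, Fin.prod_univ_two]
  refine congrArg _ (congrArg _ ?_)
  ext k
  fin_cases k <;> rfl

theorem symTwoOfCoord_symTwoCoord (x : SymmetricPower R (Fin 2) M) :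
    symTwoOfCoord b (symTwoCoord b x) = (2 : R) • x := by
  suffices h : symTwoOfCoord b ∘ₗ symTwoCoord b = (2 : R) • LinearMap.id from
    LinearMap.congr_fun h x
  refine symPow_hom_ext fun m => ?_
  obtain ⟨f, g, rfl⟩ : ∃ f g, m = ![f, g] := ⟨m 0, m 1, by
    ext i
    fin_cases i <;> rfl⟩
  simp only [LinearMap.comp_apply, symTwoOfCoord_apply,
    symTwoCoord_tprod, add_smul, Finset.sum_add_distrib, two_smul]
  refine congrArg₂ (· + ·) (tprod_pair_eq_sum b f g).symm ?_
  rw [tprod_pair_swap, tprod_pair_eq_sum b g f]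
  simp [mul_comm]

theorem symTwoCoord_symTwoOfCoord (c : Sym2 ι → R) :
    symTwoCoord b (symTwoOfCoord b c) = (2 : R) • c := by
  classical
  ext z
  induction z with | _ i j =>
  simp only [symTwoOfCoord_apply, map_sum, map_smul, Finset.sum_apply, Pi.smul_apply,
    symTwoCoord_tprod, smul_eq_mul]
  simp [mul_add, Finset.sum_add_distrib, Finsupp.single_apply, two_mul]
  rw [Sym2.eq_swap]

/-- Both composites with `symTwoOfCoord` are multiplication by 2. This serves both to count Sym² and
to detect its elements. -/
theorem symTwoCoord_bijective (h2 : IsUnit (2 : R)) : Function.Bijective (symTwoCoord b) := by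
  obtain ⟨t, ht⟩ := h2.exists_right_inv
  refine ⟨fun x y h => ?_, fun c => ⟨symTwoOfCoord b (t • c), ?_⟩⟩
  · have h' := congrArg (symTwoOfCoord b) h
    rw [symTwoOfCoord_symTwoCoord, symTwoOfCoord_symTwoCoord] at h'
    have := congrArg (t • ·) h'
    simpa only [smul_smul, mul_comm t, ht, one_smul] using this
  · rw [symTwoCoord_symTwoOfCoord, smul_smul, ht, one_smul]

end SymmetricSquare

/-! ### Detecting elements of the exterior cube and the symmetric square of the dual -/

section Detection

variable {p : ℕ} [Fact p.Prime] {V : Type u} [AddCommGroup V] [Module (ZMod p) V]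

/-- The evaluation of an element of `⋀³ V^*` at three vectors. -/
def extEval (v : Fin 3 → V) : (⋀[ZMod p]^3 (Module.Dual (ZMod p) V)) →ₗ[ZMod p] ZMod p :=
  exteriorPower.pairingDual (ZMod p) (Module.Dual (ZMod p) V) 3
    (exteriorPower.ιMulti (ZMod p) 3 fun i => Module.Dual.eval (ZMod p) V (v i))

theorem extEval_ιMulti (v : Fin 3 → V) (m : Fin 3 → Module.Dual (ZMod p) V) :
    extEval v (exteriorPower.ιMulti (ZMod p) 3 m) = Matrix.det (.of fun i j => m i (v j)) :=
  exteriorPower.pairingDual_ιMulti_ιMulti _ _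

/-- Evaluations at triples of basis vectors are the coordinates in the induced basis of ⋀³. -/
theorem eq_zero_of_extEval_eq_zero [FiniteDimensional (ZMod p) V]
    {x : ⋀[ZMod p]^3 (Module.Dual (ZMod p) V)} (h : ∀ v, extEval v x = 0) : x = 0 := by
  let b := Module.finBasis (ZMod p) V
  apply (b.dualBasis.exteriorPower 3).ext_elem
  intro s
  rw [exteriorPower.basis_repr_apply, map_zero, Finsupp.zero_apply, exteriorPower.ιMultiDual,
    exteriorPower.ιMulti_family]
  refine Eq.trans ?_ (h fun i => b (Set.powersetCard.ofFinEmbEquiv.symm s i))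
  rw [extEval]
  congr 3
  ext i f
  simp [Module.Basis.coord_apply]

/-- The value at a vector of an element of `Sym² V^*`, seen as a quadratic form. -/
def symEval (v : V) : SymmetricPower (ZMod p) (Fin 2) (Module.Dual (ZMod p) V) →ₗ[ZMod p] ZMod p :=
  symTwoLift ((LinearMap.mul (ZMod p) (ZMod p)).compl₁₂ (Module.Dual.eval (ZMod p) V v)
    (Module.Dual.eval (ZMod p) V v)) fun f g => mul_comm (f v) (g v)

theorem symEval_tprod (v : V) (m : Fin 2 → Module.Dual (ZMod p) V) :
    symEval v (SymmetricPower.tprod (ZMod p) m) = m 0 v * m 1 v :=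
  symTwoLift_tprod _ _ m

/-- Polarisation: the values of the quadratic form determine the coordinates, hence the tensor when
2 is invertible. -/
theorem symTwoCoord_eq_symEval [FiniteDimensional (ZMod p) V]
    {ι : Type*} [Fintype ι] [DecidableEq ι] (b : Module.Basis ι (ZMod p) V) (i j : ι)
    (x : SymmetricPower (ZMod p) (Fin 2) (Module.Dual (ZMod p) V)) :
    symTwoCoord b.dualBasis x s(i, j) =
      symEval (b i + b j) x - symEval (b i) x - symEval (b j) x := by
  suffices h : LinearMap.proj (R := ZMod p) (φ := fun _ : Sym2 ι => ZMod p) s(i, j) ∘ₗ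
      symTwoCoord b.dualBasis = symEval (p := p) (b i + b j) - symEval (b i) - symEval (b j) from LinearMap.congr_fun h x
  refine LinearMap.ext_on_range (SymmetricPower.span_tprod_eq_top (ZMod p) (Fin 2)
    (Module.Dual (ZMod p) V)) fun m => ?_
  simp only [LinearMap.comp_apply, LinearMap.proj_apply, LinearMap.sub_apply, symEval_tprod,
    symTwoCoord_tprod, Module.Basis.dualBasis_repr, map_add]
  ring

theorem eq_zero_of_symEval_eq_zero (hp : Odd p) [FiniteDimensional (ZMod p) V]
    {x : SymmetricPower (ZMod p) (Fin 2) (Module.Dual (ZMod p) V)}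
    (h : ∀ v, symEval v x = 0) : x = 0 := by
  let b := Module.finBasis (ZMod p) V
  apply (symTwoCoord_bijective b.dualBasis (two_ne_zero_of_odd hp).isUnit).1
  rw [map_zero]
  ext z
  induction z with | _ i j =>
  rw [symTwoCoord_eq_symEval, h, h, h, sub_zero, sub_zero, Pi.zero_apply]

theorem card_exterior_prod_symmetric (hp : Odd p) [FiniteDimensional (ZMod p) V] :
    Nat.card ((⋀[ZMod p]^3 (Module.Dual (ZMod p) V)) ×
      SymmetricPower (ZMod p) (Fin 2) (Module.Dual (ZMod p) V)) =
    p ^ ((Module.finrank (ZMod p) V).choose 3 + (Module.finrank (ZMod p) V + 1).choose 2) := by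
  let b := Module.finBasis (ZMod p) V
  rw [Nat.card_prod, Module.natCard_eq_pow_finrank (K := ZMod p), Nat.card_zmod,
    exteriorPower.finrank_eq, Subspace.dual_finrank_eq, pow_add,
    Nat.card_congr (Equiv.ofBijective _
      (symTwoCoord_bijective b.dualBasis (two_ne_zero_of_odd hp).isUnit)), Nat.card_fun,
    Nat.card_zmod, Nat.card_eq_fintype_card, Sym2.card, Fintype.card_fin]

end Detection

/-! ### The comparison map -/

section Comparison

variable {p : ℕ} (R : Type u) {V A : Type u} [CommRing R] [AddCommGroup V]
  [AddCommGroup A] [Module R A]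

variable (V A) in
/-- The third cohomology of `V` with trivial coefficients. -/
abbrev HThree : Type u := groupCohomology (Rep.trivial R (Multiplicative V) A) 3

/-- The alternating evaluation of a cohomology class at three vectors. -/
def altInvariant (u v w : V) : HThree R V A →+ A :=
  (cocycleClass R V A).toAddMonoidHom.liftOfSurjective (cocycleClass_surjective R)
    ⟨altEval R u v w, fun c hc => by
      obtain ⟨b, hb⟩ := (cocycleClass_eq_zero_iff R c).1 hc
      exact altEval_eq_zero R hb u v w⟩

theorem altInvariant_cocycleClass (u v w : V) (c : threeCocycles R V A) :
    altInvariant R u v w (cocycleClass R V A c) = altEval R u v w c :=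
  AddMonoidHom.liftOfRightInverse_comp_apply (cocycleClass R V A).toAddMonoidHom _ _ _ c

/-- The cyclic evaluation of a cohomology class at a vector. -/
def cycInvariant (u : V) (hu : p • u = 0) : HThree R V A →+ A :=
  (cocycleClass R V A).toAddMonoidHom.liftOfSurjective (cocycleClass_surjective R)
    ⟨cycEval R p u, fun c hc => by
      obtain ⟨b, hb⟩ := (cocycleClass_eq_zero_iff R c).1 hc
      exact cycEval_eq_zero R hb hu⟩

theorem cycInvariant_cocycleClass (u : V) (hu : p • u = 0) (c : threeCocycles R V A) :
    cycInvariant R u hu (cocycleClass R V A c) = cycEval R p u c :=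
  AddMonoidHom.liftOfRightInverse_comp_apply (cocycleClass R V A).toAddMonoidHom _ _ _ c

/-- H³ carries no ℤ/p-module structure a priori. Its p-torsion does, so it can serve as the target
for the universal properties of ⋀³ and Sym² over ℤ/p. -/
instance torsionModule : Module (ZMod p) (AddSubgroup.torsionBy (HThree R V A) p) :=
  AddSubgroup.torsionBy.zmodModule

variable [Fact p.Prime]

/-- The class in `H³(V, A)` of a 3-cocycle with values in `ℤ/p`. -/
def torsionClass (ι : ZMod p →+ A) : threeCocycles (ZMod p) V (ZMod p) →ₗ[ZMod p]
    AddSubgroup.torsionBy (HThree R V A) p :=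
  (((cocycleClass R V A).toAddMonoidHom.comp (threeCocyclesMap R ι)).codRestrict
    (AddSubgroup.torsionBy (HThree R V A) p) fun c => by
      change (p : ℤ) • ((cocycleClass R V A).toAddMonoidHom.comp (threeCocyclesMap R ι)) c = 0
      rw [← map_zsmul, natCast_zsmul, ← Nat.cast_smul_eq_nsmul (ZMod p), ZMod.natCast_self,
        zero_smul, map_zero]).toZModLinearMap p

variable [Module (ZMod p) V]

/-- The map `⋀³ V^* → H³(V, A)` given by the cup product. -/
def exteriorClass (hp : Odd p) (ι : ZMod p →+ A) :
    (⋀[ZMod p]^3 (Module.Dual (ZMod p) V)) →ₗ[ZMod p] AddSubgroup.torsionBy (HThree R V A) p :=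
  exteriorPower.alternatingMapLinearEquiv
    { (torsionClass R ι).compMultilinearMap tripleCup with
      map_eq_zero_of_eq' := fun m i j hm hij => by
        obtain ⟨b, hb⟩ := tripleCup_eq_twoCoboundary hp m hm hij
        exact Subtype.ext ((cocycleClass_eq_zero_iff R _).2
          ⟨_, threeCocyclesMap_eq_twoCoboundary R ι hb⟩) }

theorem exteriorClass_ιMulti (hp : Odd p) (ι : ZMod p →+ A) (m : Fin 3 → Module.Dual (ZMod p) V) :
    exteriorClass R hp ι (exteriorPower.ιMulti (ZMod p) 3 m) = torsionClass R ι (tripleCup m) :=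
  exteriorPower.alternatingMapLinearEquiv_apply_ιMulti _ m

theorem torsionClass_cupBockstein_comm {ε : ℤ →+ A} (hε : ε ((p : ℤ) * p) = 0)
    (f g : Module.Dual (ZMod p) V) : torsionClass R (coeffHom ε hε) (cupBockstein g f) =
      torsionClass R (coeffHom ε hε) (cupBockstein f g) := by
  rw [← sub_eq_zero, ← map_sub]
  exact Subtype.ext ((cocycleClass_eq_zero_iff R _).2
    ⟨_, cupBockstein_sub_swap_eq_twoCoboundary ε hε R f g⟩)

/-- The map `Sym² V^* → H³(V, A)` given by the cup product with the Bockstein. -/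
def symmetricClass {ε : ℤ →+ A} (hε : ε ((p : ℤ) * p) = 0) :
    SymmetricPower (ZMod p) (Fin 2) (Module.Dual (ZMod p) V) →ₗ[ZMod p]
      AddSubgroup.torsionBy (HThree R V A) p :=
  symTwoLift
    (LinearMap.mk₂ (ZMod p) (fun f g => torsionClass R (coeffHom ε hε) (cupBockstein g f))
      (fun f f' g => by rw [map_add, map_add])
      (fun c f g => by rw [map_smul, map_smul])
      -- The carry is not additive in g on cochains; linearity in g is borrowed from linearity in f
      -- through the symmetry of the classes.
      (fun f g g' => by
        simp only [torsionClass_cupBockstein_comm R hε f, map_add])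
      (fun c f g => by
        simp only [torsionClass_cupBockstein_comm R hε f, map_smul]))
    fun f g => torsionClass_cupBockstein_comm R hε f g

theorem symmetricClass_tprod {ε : ℤ →+ A} (hε : ε ((p : ℤ) * p) = 0)
    (m : Fin 2 → Module.Dual (ZMod p) V) :
    symmetricClass R hε (SymmetricPower.tprod (ZMod p) m) =
      torsionClass R (coeffHom ε hε) (cupBockstein (m 1) (m 0)) :=
  symTwoLift_tprod _ _ m

/-- The map `⋀³ V^* × Sym² V^* → H³(V, A)`. -/
def comparison (hp : Odd p) {ε : ℤ →+ A} (hε : ε ((p : ℤ) * p) = 0) :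
    (⋀[ZMod p]^3 (Module.Dual (ZMod p) V)) ×
      SymmetricPower (ZMod p) (Fin 2) (Module.Dual (ZMod p) V) →+ HThree R V A :=
  (AddSubgroup.torsionBy (HThree R V A) p).subtype.comp
    ((exteriorClass R hp (coeffHom ε hε)).coprod (symmetricClass R hε)).toAddMonoidHom

theorem comparison_apply (hp : Odd p) {ε : ℤ →+ A} (hε : ε ((p : ℤ) * p) = 0)
    (x : ⋀[ZMod p]^3 (Module.Dual (ZMod p) V))
    (y : SymmetricPower (ZMod p) (Fin 2) (Module.Dual (ZMod p) V)) :
    comparison R hp hε (x, y) = (exteriorClass R hp (coeffHom ε hε) x : HThree R V A) +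
      (symmetricClass R hε y : HThree R V A) := rfl

/-- Reduces an identity of additive maps out of ⋀³ to decomposable elements; used for the invariants
and for equivariance. -/
theorem addMonoidHom_comp_exteriorClass {B : Type*} [AddCommGroup B] (hp : Odd p) (ι : ZMod p →+ A)
    (F : HThree R V A →+ B) (G : (⋀[ZMod p]^3 (Module.Dual (ZMod p) V)) →+ B)
    (h : ∀ m, F (cocycleClass R V A (threeCocyclesMap R ι (tripleCup m))) =
      G (exteriorPower.ιMulti (ZMod p) 3 m)) (x : ⋀[ZMod p]^3 (Module.Dual (ZMod p) V)) :
    F (exteriorClass R hp ι x) = G x := by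
  suffices e : (F.comp (AddSubgroup.subtype _)).comp (exteriorClass R hp ι).toAddMonoidHom = G from
    DFunLike.congr_fun e x
  refine addMonoidHom_eq_of_span_eq_top
    (exteriorPower.ιMulti_span (ZMod p) 3 (Module.Dual (ZMod p) V)) ?_
  rintro _ ⟨m, rfl⟩
  rw [← h]
  exact congrArg (fun z => F (Subtype.val z)) (exteriorClass_ιMulti R hp ι m)

theorem addMonoidHom_comp_symmetricClass {B : Type*} [AddCommGroup B] {ε : ℤ →+ A}
    (hε : ε ((p : ℤ) * p) = 0) (F : HThree R V A →+ B)
    (G : SymmetricPower (ZMod p) (Fin 2) (Module.Dual (ZMod p) V) →+ B)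
    (h : ∀ m : Fin 2 → Module.Dual (ZMod p) V,
      F (cocycleClass R V A (threeCocyclesMap R (coeffHom ε hε) (cupBockstein (m 1) (m 0)))) =
      G (SymmetricPower.tprod (ZMod p) m))
    (x : SymmetricPower (ZMod p) (Fin 2) (Module.Dual (ZMod p) V)) :
    F (symmetricClass R hε x) = G x := by
  suffices e : (F.comp (AddSubgroup.subtype _)).comp (symmetricClass R hε).toAddMonoidHom = G from
    DFunLike.congr_fun e x
  refine addMonoidHom_eq_of_span_eq_top (p := p)
    (S := Set.range (SymmetricPower.tprod (ZMod p) (ι := Fin 2) (M := Module.Dual (ZMod p) V)))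
    (SymmetricPower.span_tprod_eq_top (ZMod p) (Fin 2) (Module.Dual (ZMod p) V)) ?_
  rintro _ ⟨m, rfl⟩
  rw [← h]
  exact congrArg (fun z => F (Subtype.val z)) (symmetricClass_tprod R hε m)

theorem altInvariant_comparison (hp : Odd p) {ε : ℤ →+ A} (hε : ε ((p : ℤ) * p) = 0)
    (v : Fin 3 → V) (x : ⋀[ZMod p]^3 (Module.Dual (ZMod p) V))
    (y : SymmetricPower (ZMod p) (Fin 2) (Module.Dual (ZMod p) V)) :
    altInvariant R (v 0) (v 1) (v 2) (comparison R hp hε (x, y)) =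
      coeffHom ε hε (extEval v x) := by
  rw [comparison_apply, map_add,
    addMonoidHom_comp_exteriorClass R hp _ _ ((coeffHom ε hε).comp (extEval v).toAddMonoidHom)
      (fun m => ?_) x,
    addMonoidHom_comp_symmetricClass R hε _ 0 (fun m => ?_) y]
  · exact add_zero _
  · rw [altInvariant_cocycleClass, altEval_threeCocyclesMap, altEval_cupBockstein, map_zero]
    rfl
  · rw [altInvariant_cocycleClass, altEval_threeCocyclesMap, altEval_tripleCup]
    exact congrArg _ (extEval_ιMulti v m).symm

theorem cycInvariant_comparison (hp : Odd p) {ε : ℤ →+ A} (hε : ε ((p : ℤ) * p) = 0)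
    (v : V) (hv : p • v = 0) (x : ⋀[ZMod p]^3 (Module.Dual (ZMod p) V))
    (y : SymmetricPower (ZMod p) (Fin 2) (Module.Dual (ZMod p) V)) :
    cycInvariant R v hv (comparison R hp hε (x, y)) = coeffHom ε hε (symEval v y) := by
  rw [comparison_apply, map_add,
    addMonoidHom_comp_exteriorClass R hp _ _ 0 (fun m => ?_) x,
    addMonoidHom_comp_symmetricClass R hε _ ((coeffHom ε hε).comp (symEval v).toAddMonoidHom)
      (fun m => ?_) y]
  · exact zero_add _
  · rw [cycInvariant_cocycleClass, cycEval_threeCocyclesMap, cycEval_cupBockstein]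
    exact congrArg _ (symEval_tprod v m).symm
  · rw [cycInvariant_cocycleClass, cycEval_threeCocyclesMap, cycEval_tripleCup hp, map_zero]
    rfl

/-- The alternating invariant sees only the ⋀³ component and the cyclic one only the Sym² component,
and each family separates points. -/
theorem comparison_injective [FiniteDimensional (ZMod p) V] (hp : Odd p) {ε : ℤ →+ A}
    (hε : ε ((p : ℤ) * p) = 0) (hinj : Function.Injective (coeffHom ε hε)) :
    Function.Injective (comparison (V := V) R hp hε) := by
  rw [injective_iff_map_eq_zero]
  rintro ⟨x, y⟩ h
  have hx : x = 0 := eq_zero_of_extEval_eq_zero fun v => hinj (by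
    rw [← altInvariant_comparison R hp hε v x y, h, map_zero, map_zero])
  have hy : y = 0 := eq_zero_of_symEval_eq_zero hp fun v => hinj (by
    have hv : p • v = 0 := by rw [← Nat.cast_smul_eq_nsmul (ZMod p), ZMod.natCast_self, zero_smul]
    rw [← cycInvariant_comparison R hp hε v hv x y, h, map_zero, map_zero])
  rw [hx, hy]
  rfl

end Comparison

/-! ### Equivariance and the choice of roots of unity -/

section Units

variable {p : ℕ} [Fact p.Prime] {V k : Type u} [AddCommGroup V] [Module (ZMod p) V] [Field k]

/-- On generators, pulling a cocycle back along g⁻¹ replaces each linear form by its composite with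
g⁻¹, which is the dual action. -/
theorem cohomologyRep_comparison (hp : Odd p) {ε : ℤ →+ Additive kˣ} (hε : ε ((p : ℤ) * p) = 0)
    (g : LinearMap.GeneralLinearGroup (ZMod p) V)
    (z : (⋀[ZMod p]^3 (Module.Dual (ZMod p) V)) ×
      SymmetricPower (ZMod p) (Fin 2) (Module.Dual (ZMod p) V)) :
    cohomologyRep p V k 3 g (comparison (ULift.{u} ℤ) hp hε z) =
      comparison (ULift.{u} ℤ) hp hε
        (((exteriorPowerRep 3 (dualRep p V)).prod (symmetricPowerRep 2 (dualRep p V))) g z) := by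
  obtain ⟨x, y⟩ := z
  have hF : ∀ c, (cohomologyRep p V k 3 g).toAddMonoidHom (cocycleClass (ULift.{u} ℤ) _ _ c) =
      cocycleClass (ULift.{u} ℤ) V (Additive kˣ) (threeCocyclesComap
        ((g⁻¹ : LinearMap.GeneralLinearGroup (ZMod p) V) : V →ₗ[ZMod p] V).toAddMonoidHom c) :=
    fun c => pullback_cocycleClass k _ c
  have hx := addMonoidHom_comp_exteriorClass (ULift.{u} ℤ) hp (coeffHom ε hε)
    (cohomologyRep p V k 3 g).toAddMonoidHom
    ((AddSubgroup.subtype _).comp ((exteriorClass (ULift.{u} ℤ) hp (coeffHom ε hε)).comp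
      (exteriorPowerRep 3 (dualRep p V) g)).toAddMonoidHom) (fun m => by
        rw [hF]
        refine Eq.symm (congrArg Subtype.val
          ((congrArg _ (exteriorPower.map_apply_ιMulti _ m)).trans (exteriorClass_ιMulti _ hp _ _)))) x
  have hy := addMonoidHom_comp_symmetricClass (ULift.{u} ℤ) hε
    (cohomologyRep p V k 3 g).toAddMonoidHom
    ((AddSubgroup.subtype _).comp ((symmetricClass (ULift.{u} ℤ) hε).comp
      (symmetricPowerRep 2 (dualRep p V) g)).toAddMonoidHom) (fun m => by
        rw [hF]
        refine Eq.symm (congrArg Subtype.val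
          ((congrArg _ (symPowMap_tprod _ m)).trans (symmetricClass_tprod _ hε _)))) y
  rw [comparison_apply]
  exact (map_add _ _ _).trans (congrArg₂ (· + ·) hx hy)

/-- Take ε(n) = ηⁿ with η a primitive p²-th root of unity; then ε(p n) = 1 exactly when p divides n.
-/
theorem exists_coeffHom_injective (k : Type u) [Field k] [IsAlgClosed k] [CharZero k] :
    ∃ (ε : ℤ →+ Additive kˣ) (hε : ε ((p : ℤ) * p) = 0), Function.Injective (coeffHom ε hε) := by
  have hp0 : p ≠ 0 := NeZero.ne p
  have : NeZero ((p * p : ℕ) : k) := ⟨Nat.cast_ne_zero.2 (mul_ne_zero hp0 hp0)⟩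
  have : NeZero (p * p) := ⟨mul_ne_zero hp0 hp0⟩
  obtain ⟨ζ, hζ⟩ := HasEnoughRootsOfUnity.exists_primitiveRoot k (p * p)
  obtain ⟨η, rfl⟩ := hζ.isUnit (mul_ne_zero hp0 hp0)
  have hη : IsPrimitiveRoot η (p * p) := IsPrimitiveRoot.coe_units_iff.1 hζ
  let ε : ℤ →+ Additive kˣ := zmultiplesHom _ (Additive.ofMul η)
  have hker : ∀ n : ℤ, ε n = 0 ↔ ((p * p : ℕ) : ℤ) ∣ n := fun n =>
    hη.zpow_eq_one_iff_dvd n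
  refine ⟨ε, (hker _).2 (by push_cast; rfl), ?_⟩
  rw [injective_iff_map_eq_zero]
  intro a ha
  rw [← ZMod.intCast_zmod_cast a] at ha ⊢
  rw [coeffHom_intCast, hker, Nat.cast_mul,
    mul_dvd_mul_iff_left (Nat.cast_ne_zero.2 hp0)] at ha
  exact (ZMod.intCast_zmod_eq_zero_iff_dvd _ _).2 ha

end Units

end ElemAbelian

end

theorem propositionH3 (p : ℕ) [Fact p.Prime] (hp : Odd p)
    (k : Type u) [Field k] [IsAlgClosed k] [CharZero k]
    (V : Type u) [AddCommGroup V] [Module (ZMod p) V] [FiniteDimensional (ZMod p) V] :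
    ∃ e : ElemAbelian.unitsCohomology V k 3 ≃+
        (⋀[ZMod p]^3 (Module.Dual (ZMod p) V)) ×
          SymmetricPower (ZMod p) (Fin 2) (Module.Dual (ZMod p) V),
      ∀ (g : LinearMap.GeneralLinearGroup (ZMod p) V) (ω : ElemAbelian.unitsCohomology V k 3),
        e (ElemAbelian.cohomologyRep p V k 3 g ω) =
          ((ElemAbelian.exteriorPowerRep 3 (ElemAbelian.dualRep p V)).prod
            (ElemAbelian.symmetricPowerRep 2 (ElemAbelian.dualRep p V))) g (e ω) := by
  obtain ⟨ε, hε, hinj⟩ := ElemAbelian.exists_coeffHom_injective (p := p) k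
  have hΦ := ElemAbelian.comparison_injective (ULift.{u} ℤ) (V := V) hp hε hinj
  obtain ⟨hfin, hcard⟩ := (ElemAbelian.cardLE_units_two_three k
    (Module.finrank (ZMod p) V) (Multiplicative V)
    (fun v => by
      change p • v.toAdd = 0
      rw [← Nat.cast_smul_eq_nsmul (ZMod p), ZMod.natCast_self, zero_smul])
    ((Nat.card_congr Multiplicative.toAdd).trans
      (by rw [Module.natCard_eq_pow_finrank (K := ZMod p), Nat.card_zmod]))).2
  rw [← ElemAbelian.card_exterior_prod_symmetric hp] at hcard
  -- The cohomology is finite and no larger than the source, so the injection is bijective.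
  have hbij := (Nat.bijective_iff_injective_and_card _).2
    ⟨hΦ, le_antisymm (Nat.card_le_card_of_injective _ hΦ) hcard⟩
  let e := AddEquiv.ofBijective _ hbij
  refine ⟨e.symm, fun g ω => ?_⟩
  obtain ⟨z, rfl⟩ := e.surjective ω
  rw [e.symm_apply_apply, AddEquiv.symm_apply_eq]
  exact ElemAbelian.cohomologyRep_comparison hp hε g z
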